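/- Let $\mathbb{H}$ be the hexagonal lattice, partitioned into its two sublattices $\mathcal{A}$ and $\mathcal{B}$, so that the three nearest neighbours of every site of one sublattice lie in the other. For $\lambda\in[0,1]$ let $P_\lambda$ be the law of the initial configuration $\sigma^0\in\{-1,+1\}^{\mathbb{H}}$ whose spins are i.i.d. with $P_\lambda(\sigma^0_x=+1)=\lambda$. Given $\sigma^0$, the synchronous zero-temperature dynamics $(\sigma^n)_{n\ge 0}$ of the homogeneous Ising ferromagnet with zero external field is the following deterministic cellular automaton: at each odd time $n=1,3,5,\dots$ all sites of $\mathcal{A}$ are updated simultaneously, and at each even time $n=2,4,6,\dots$ all sites of $\mathcal{B}$ are updated simultaneously; when a site $x$ is updated, its spin is flipped if $\Delta\mathcal{H}_x(\sigma)=2\sum_{y\sim x}\sigma_x\sigma_y<0$ (that is, if it disagrees with the majority of its three neighbours), and is left unchanged otherwise. We say that $x$ flips at time $n\ge1$ if $\sigma^n_x\ne\sigma^{n-1}_x$. **Theorem.** (i) For every initial configuration, each site of $\mathcal{B}$ flips at most once. (ii) For every initial configuration, $\sigma^n$ converges sitewise as $n\to\infty$ to a limit $\sigma^\infty$; that is,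 for each $x$, $\sigma^n_x=\sigma^\infty_x$ for all sufficiently large $n$. (iii) The convergence is exponentially fast: for every $\lambda\in[0,1]$ there is $c=c(\lambda)\in(0,\infty)$ such that for every site $x$ (of $\mathcal{A}$ or of $\mathcal{B}$) and every integer $n\ge0$, $$P_\lambda(x\text{ flips at some time }m>n)\le e^{-cn}.$$ -/

import Mathlib

open MeasureTheory ProbabilityTheory

namespace HexIsing

/-- Sites of the hexagonal lattice `ℍ`, given by its two sublattices `𝒜` and `ℬ`.
With `u = (√3, 0)` and `v = (√3/2, 3/2)`, the site `B i j` sits at the point `i • u + j • v` of the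
plane and the site `A i j` at `i • u + j • v + (√3/2, 1/2)`; the edges are the pairs of
points at distance `1`. The origin of `ℍ` is `B 0 0`. -/
inductive Site : Type where
  | A (i j : ℤ) : Site
  | B (i j : ℤ) : Site
  deriving DecidableEq

/-- The set `𝒩(x)` of the three nearest neighbours of `x` in `ℍ`. -/
def nbrs : Site → Finset Site
  | .A i j => {.B i j, .B (i + 1) j, .B i (j + 1)}
  | .B i j => {.A i j, .A (i - 1) j, .A i (j - 1)}

theorem mem_nbrs_comm (x y : Site) : x ∈ nbrs y ↔ y ∈ nbrs x := by
  cases x <;> cases y <;> simp [nbrs] <;> grind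

theorem card_nbrs (x : Site) : (nbrs x).card = 3 := by
  cases x <;> rw [nbrs, Finset.card_eq_three] <;> exact ⟨_, _, _, by simp <;> omega, by simp <;> omega, by simp <;> omega, rfl⟩

/-- The hexagonal lattice as a graph. -/
def hexLattice : SimpleGraph Site where
  Adj x y := y ∈ nbrs x
  symm := ⟨fun x y h => (mem_nbrs_comm y x).1 h⟩
  loopless := ⟨fun x h => by cases x <;> simp [nbrs] at h⟩

/-- Spin configurations: assignments of `+1` or `-1` to every site (`ℤˣ = {1, -1}`). -/
abbrev Config : Type := Site → ℤˣ

/-- The energy change `Δℋ_x(σ) = 2 ∑_{y ∈ 𝒩(x)} σ_x σ_y` caused by flipping the spin at `x`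
(homogeneous ferromagnet, no external field). -/
def energyChange (σ : Config) (x : Site) : ℤ :=
  2 * ∑ y ∈ nbrs x, (σ x : ℤ) * (σ y : ℤ)

/-- The zero-temperature rule: the spin at `x` is flipped exactly when this lowers the energy, i.e.
when it disagrees with a majority of its three neighbours (no ties can occur). -/
def updateSpin (σ : Config) (x : Site) : ℤˣ :=
  if energyChange σ x < 0 then -σ x else σ x

/-- Simultaneous update of all sites of the sublattice `𝒜`. -/
def updateA (σ : Config) : Config
  | .A i j => updateSpin σ (.A i j)
  | .B i j => σ (.B i j)

/-- Simultaneous update of all sites of the sublattice `ℬ`. -/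
def updateB (σ : Config) : Config
  | .A i j => σ (.A i j)
  | .B i j => updateSpin σ (.B i j)

/-- The synchronous dynamics: `evolve σ n` is the configuration at time `n` started from `σ` at
time `0`. The sublattice `𝒜` is updated at times `1, 3, 5, …`, and `ℬ` at times `2, 4, 6, …`. -/
def evolve (σ : Config) : ℕ → Config
  | 0 => σ
  | n + 1 => if Even n then updateA (evolve σ n) else updateB (evolve σ n)

/-- Started from `σ`, the site `x` flips at the time step from `m` to `m + 1`. -/
def FlipsAtStep (σ : Config) (x : Site) (m : ℕ) : Prop :=
  evolve σ (m + 1) x ≠ evolve σ m x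

/-- Started from `σ`, the site `x` flips after time `n`, i.e. at some time `m + 1 > n`. -/
def FlipsAfter (σ : Config) (x : Site) (n : ℕ) : Prop :=
  ∃ m, n ≤ m ∧ FlipsAtStep σ x m

/-- The law of the initial configuration: the spins are i.i.d., each equal to `+1` with
probability `p` and to `-1` with probability `1 - p`. -/
noncomputable def initialLaw (p : unitInterval) : Measure Config :=
  Measure.infinitePi fun _ : Site => bernoulliMeasure (1 : ℤˣ) (-1) p

end HexIsing

/-!
On `ℬ` alone, one update of `𝒜` followed by one of `ℬ` is a cellular automaton on a triangular
lattice. Its triangles are of two kinds: *stars*, the neighbourhoods of the `𝒜`-sites, and *faces*,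
the `ℬ`-sites of a hexagon of `ℍ`. A `ℬ`-site flips exactly when two of its three stars disagree
with it, and every site of a constant face has two stars with two sites in that face, so constant
faces are stable (`spinB_eq_of_face`). When `v` flips, the face at `v` between two disagreeing stars
becomes constant (`exists_face_of_stepB`). Hence a `ℬ`-site flips at most once, and convergence
follows, since from time `1` on an `𝒜`-site flips only right after one of its neighbours.

If `x` flips at the `(k + 1)`-st update of `ℬ`, one of its neighbours flipped from the same spin at
the `k`-th update, and so on. This gives a path of `k` steps from `x` whose sites all have the same
initial spin `s`. It is induced in the triangular lattice, and no edge of it lies in an initially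
constant face, so the third vertex of that face, the *corner* of the edge, has initial spin `-s`
(`exists_mem_prescribed_of_flip`). An induced path turns by at most 60 degrees, and two of its
edges share a corner only if they are two steps apart with both turns between them around that
corner (`IsInduced.corner_notMem`). So, if `q` is the probability of `s`, each of the three possible
steps costs a factor `q (1 - q)`, except that the second turn around a corner may cost only `q`.
With the potential `3 / 2` after a first turn around a corner and `1` otherwise, the weighted number
of paths decreases by the factor `7 / 8` per step for every `q`
(`initialLaw_extensionEvent_le`). This beats `exp (-c n)` for large `n` and small `c`; for the other
`n ≥ 1` it suffices that a flip after time `1` is excluded with a probability bounded below, by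
constant faces near `x` (`initialLaw_flipsAfter_one_le`).
-/

namespace HexIsing

/-! ### The dynamics of the sublattice `ℬ` -/

/-- The majority of three spins. -/
def maj (x y z : ℤˣ) : ℤˣ := if x = y then x else z

theorem maj_eq_iff (x y z t : ℤˣ) :
    maj x y z = t ↔ (x = t ∧ y = t) ∨ (y = t ∧ z = t) ∨ (x = t ∧ z = t) := by
  revert x y z t; decide

theorem updateSpin_eq_maj_of_nbrs (σ : Config) {x a b c : Site} (hx : nbrs x = {a, b, c})
    (hab : a ≠ b) (hac : a ≠ c) (hbc : b ≠ c) : updateSpin σ x = maj (σ a) (σ b) (σ c) := by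
  have hsum : ∑ y ∈ nbrs x, (σ x : ℤ) * (σ y : ℤ)
      = (σ x : ℤ) * (σ a : ℤ) + ((σ x : ℤ) * (σ b : ℤ) + (σ x : ℤ) * (σ c : ℤ)) := by
    rw [hx, Finset.sum_insert (by simp [hab, hac]), Finset.sum_insert (by simp [hbc]),
      Finset.sum_singleton]
  rw [updateSpin, energyChange, hsum]
  generalize σ x = u, σ a = p, σ b = q, σ c = r
  revert u p q r
  decide

theorem updateSpin_A (σ : Config) (i j : ℤ) :
    updateSpin σ (.A i j) = maj (σ (.B i j)) (σ (.B (i + 1) j)) (σ (.B i (j + 1))) :=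
  updateSpin_eq_maj_of_nbrs σ rfl (by simp) (by simp) (by simp)

theorem updateSpin_B (σ : Config) (i j : ℤ) :
    updateSpin σ (.B i j) = maj (σ (.A i j)) (σ (.A (i - 1) j)) (σ (.A i (j - 1))) :=
  updateSpin_eq_maj_of_nbrs σ rfl (by simp; omega) (by simp; omega) (by simp)

theorem maj_rotate (x y z : ℤˣ) : maj x y z = maj y z x := by
  revert x y z; decide

/-- The majority of the spins `b` on the three neighbours of `A v.1 v.2`. -/
def starMaj (b : ℤ × ℤ → ℤˣ) (v : ℤ × ℤ) : ℤˣ :=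
  maj (b v) (b (v.1 + 1, v.2)) (b (v.1, v.2 + 1))

/-- Two consecutive updates, first of `𝒜` and then of `ℬ`, seen on `ℬ` only. -/
def stepB (b : ℤ × ℤ → ℤˣ) (v : ℤ × ℤ) : ℤˣ :=
  maj (starMaj b v) (starMaj b (v.1 - 1, v.2)) (starMaj b (v.1, v.2 - 1))

/-- The configuration on `ℬ`, indexed by `ℤ × ℤ`, after `k` updates of `ℬ`, that is, at the
times `2 * k` and `2 * k + 1`. -/
def spinB (σ : Config) (k : ℕ) (v : ℤ × ℤ) : ℤˣ := evolve σ (2 * k) (.B v.1 v.2)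

theorem evolve_two_mul_add_one (σ : Config) (k : ℕ) :
    evolve σ (2 * k + 1) = updateA (evolve σ (2 * k)) := by
  simp [evolve]

theorem evolve_two_mul_add_two (σ : Config) (k : ℕ) :
    evolve σ (2 * k + 2) = updateB (evolve σ (2 * k + 1)) := by
  rw [evolve, if_neg (by simp)]

theorem evolve_odd_A (σ : Config) (k : ℕ) (i j : ℤ) :
    evolve σ (2 * k + 1) (.A i j) = starMaj (spinB σ k) (i, j) := by
  rw [evolve_two_mul_add_one]
  exact updateSpin_A _ i j

theorem spinB_succ (σ : Config) (k : ℕ) : spinB σ (k + 1) = stepB (spinB σ k) := by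
  funext v
  have h : spinB σ (k + 1) v = updateSpin (evolve σ (2 * k + 1)) (.B v.1 v.2) := by
    rw [spinB, show 2 * (k + 1) = 2 * k + 2 by ring, evolve_two_mul_add_two]
    rfl
  rw [h, updateSpin_B]
  simp only [evolve_odd_A, stepB]

theorem flipsAtStep_B_iff (σ : Config) (i j : ℤ) (m : ℕ) :
    FlipsAtStep σ (.B i j) m ↔
      ∃ k, m = 2 * k + 1 ∧ spinB σ (k + 1) (i, j) ≠ spinB σ k (i, j) := by
  rcases Nat.even_or_odd' m with ⟨k, rfl | rfl⟩
  · constructor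
    · intro h
      refine absurd ?_ h
      rw [evolve_two_mul_add_one]
      rfl
    · rintro ⟨l, hl, -⟩
      omega
  · have h : evolve σ (2 * k + 1) (.B i j) = spinB σ k (i, j) := by
      rw [evolve_two_mul_add_one]
      rfl
    have h' : FlipsAtStep σ (.B i j) (2 * k + 1) ↔
        spinB σ (k + 1) (i, j) ≠ spinB σ k (i, j) := by
      rw [FlipsAtStep, h]
      rfl
    rw [h']
    constructor
    · exact fun hk => ⟨k, rfl, hk⟩
    · rintro ⟨l, hl, hk⟩
      obtain rfl : k = l := by omega
      exact hk

/-- From time `1` on, an `𝒜`-site follows its neighbours: it flips only right after one of them. -/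
theorem flipsAtStep_A_succ {σ : Config} {i j : ℤ} {m : ℕ} (h : FlipsAtStep σ (.A i j) (m + 1)) :
    FlipsAtStep σ (.B i j) m ∨ FlipsAtStep σ (.B (i + 1) j) m ∨
      FlipsAtStep σ (.B i (j + 1)) m := by
  rcases Nat.even_or_odd' m with ⟨k, rfl | rfl⟩
  · refine absurd ?_ h
    rw [show 2 * k + 1 + 1 = 2 * k + 2 by ring, evolve_two_mul_add_two]
    rfl
  · by_contra! hn
    simp only [flipsAtStep_B_iff, not_exists, not_and, not_not] at hn
    obtain ⟨h0, h1, h2⟩ := hn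
    have e1 : evolve σ (2 * k + 1 + 1 + 1) (.A i j) = starMaj (spinB σ (k + 1)) (i, j) := by
      rw [← evolve_odd_A]
      rfl
    have e0 : evolve σ (2 * k + 1 + 1) (.A i j) = starMaj (spinB σ k) (i, j) := by
      rw [← evolve_odd_A, show 2 * k + 1 + 1 = 2 * k + 2 by ring, evolve_two_mul_add_two]
      rfl
    refine h ?_
    rw [e1, e0]
    simp only [starMaj]
    rw [h0 k rfl, h1 k rfl, h2 k rfl]

/-! ### Geometry of the triangular lattice formed by `ℬ` -/

/-- The six vectors, in cyclic order, from a `ℬ`-site to its nearest `ℬ`-sites. Two consecutive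
ones span with the site a triangle, which is either the neighbourhood of an `𝒜`-site (a *star*)
or the set of `ℬ`-sites of a hexagonal face of `ℍ`; the two kinds alternate. -/
def dir : Fin 6 → ℤ × ℤ := ![(1, 0), (0, 1), (-1, 1), (-1, 0), (0, -1), (1, -1)]

/-- The direction that spans a star together with `dir h`. -/
def starMate : Fin 6 → Fin 6 := ![1, 0, 3, 2, 5, 4]

/-- The direction that spans a face of `ℍ` together with `dir h`. -/
def faceMate : Fin 6 → Fin 6 := ![5, 2, 1, 4, 3, 0]

/-- Two sites of the triangular lattice are equal or adjacent. -/
def Near (u v : ℤ × ℤ) : Prop := u = v ∨ ∃ h, u = v + dir h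

/-- The update in terms of the six neighbours: `dir 0, dir 1`, then `dir 2, dir 3`, and then
`dir 4, dir 5` span the three stars at `v`. -/
theorem stepB_eq_maj (b : ℤ × ℤ → ℤˣ) (v : ℤ × ℤ) :
    stepB b v = maj (maj (b v) (b (v + dir 0)) (b (v + dir 1)))
      (maj (b v) (b (v + dir 2)) (b (v + dir 3)))
      (maj (b v) (b (v + dir 4)) (b (v + dir 5))) := by
  obtain ⟨i, j⟩ := v
  simp only [stepB, starMaj, dir, Matrix.cons_val, Prod.mk_add_mk, add_zero, sub_add_cancel,
    ← sub_eq_add_neg]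
  rw [maj_rotate (b (i - 1, j)), ← maj_rotate (b (i, j)) (b (i, j - 1)) (b (i + 1, j - 1))]

/-- A site flips exactly when at least two of its three stars disagree with it. -/
theorem stepB_eq_iff_of_ne (b : ℤ × ℤ → ℤˣ) (v : ℤ × ℤ) {s t : ℤˣ} (hst : t ≠ s) (hv : b v = s) :
    stepB b v = t ↔
      ((b (v + dir 0) = t ∧ b (v + dir 1) = t) ∧ (b (v + dir 2) = t ∧ b (v + dir 3) = t)) ∨
      ((b (v + dir 2) = t ∧ b (v + dir 3) = t) ∧ (b (v + dir 4) = t ∧ b (v + dir 5) = t)) ∨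
      ((b (v + dir 0) = t ∧ b (v + dir 1) = t) ∧ (b (v + dir 4) = t ∧ b (v + dir 5) = t)) := by
  rw [stepB_eq_maj, maj_eq_iff]
  have h : ¬ b v = t := by rw [hv]; exact hst.symm
  simp only [maj_eq_iff, h, false_and, false_or, or_false]

/-- Every vertex of a constant face has two stars with a majority from that face. -/
theorem stepB_eq_of_face {b : ℤ × ℤ → ℤˣ} {v : ℤ × ℤ} {s : ℤˣ} (h : Fin 6) (hv : b v = s)
    (h1 : b (v + dir h) = s) (h2 : b (v + dir (faceMate h)) = s) : stepB b v = s := by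
  rw [stepB_eq_maj]
  simp only [maj_eq_iff]
  fin_cases h <;> simp [faceMate] at h1 h2 <;> tauto

theorem exists_faceMate_dir (h : Fin 6) : ∃ g, -dir h = dir g ∧
    dir (faceMate h) - dir h = dir (faceMate g) := by
  revert h; decide

theorem faceMate_faceMate (h : Fin 6) : faceMate (faceMate h) = h := by
  revert h; decide

/-- A constant face is stable. -/
theorem spinB_eq_of_face {σ : Config} {k : ℕ} {v : ℤ × ℤ} {s : ℤˣ} {h : Fin 6}
    (hv : spinB σ k v = s) (h1 : spinB σ k (v + dir h) = s)
    (h2 : spinB σ k (v + dir (faceMate h)) = s) {l : ℕ} (hl : k ≤ l) :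
    spinB σ l v = s ∧ spinB σ l (v + dir h) = s ∧ spinB σ l (v + dir (faceMate h)) = s := by
  -- the face seen from an arbitrary vertex of it
  have key : ∀ (b : ℤ × ℤ → ℤˣ) (h : Fin 6), b v = s → b (v + dir h) = s →
      b (v + dir (faceMate h)) = s → stepB b (v + dir h) = s := by
    intro b h hv h1 h2
    obtain ⟨g, hg, hg'⟩ := exists_faceMate_dir h
    refine stepB_eq_of_face g h1 ?_ ?_
    · rw [← hg, add_neg_cancel_right]; exact hv
    · rw [← hg', add_assoc, add_sub_cancel]; exact h2
  induction l, hl using Nat.le_induction with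
  | base => exact ⟨hv, h1, h2⟩
  | succ l _ ih =>
    obtain ⟨i0, i1, i2⟩ := ih
    rw [spinB_succ]
    exact ⟨stepB_eq_of_face h i0 i1 i2, key _ h i0 i1 i2,
      key _ (faceMate h) i0 i2 (by rw [faceMate_faceMate]; exact i1)⟩

/-- Two stars at `v` with all other spins equal to `t` leave fixed the two sites of the face
between them, so that this face is constant after `v` has taken the value `t`. -/
theorem exists_face_of_stepB {b : ℤ × ℤ → ℤˣ} {v : ℤ × ℤ} {t : ℤˣ} (hv : b v ≠ t)
    (hs : stepB b v = t) :
    ∃ h, stepB b (v + dir h) = t ∧ stepB b (v + dir (faceMate h)) = t := by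
  rw [stepB_eq_iff_of_ne b v hv.symm rfl] at hs
  obtain ⟨i, j⟩ := v
  simp only [dir, Matrix.cons_val, Prod.mk_add_mk, add_zero, ← sub_eq_add_neg] at hs
  have e1 : ∀ i : ℤ, i - 1 + 1 = i := fun i => by ring
  have e2 : ∀ i : ℤ, i + 1 - 1 = i := fun i => by ring
  rcases hs with hs | hs | hs
  · refine ⟨1, ?_⟩
    simp only [stepB, starMaj, maj_eq_iff, faceMate, dir, Matrix.cons_val, Prod.mk_add_mk,
      add_zero, ← sub_eq_add_neg, e1, e2]
    tauto
  · refine ⟨3, ?_⟩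
    simp only [stepB, starMaj, maj_eq_iff, faceMate, dir, Matrix.cons_val, Prod.mk_add_mk,
      add_zero, ← sub_eq_add_neg, e1]
    tauto
  · refine ⟨5, ?_⟩
    simp only [stepB, starMaj, maj_eq_iff, faceMate, dir, Matrix.cons_val, Prod.mk_add_mk,
      add_zero, ← sub_eq_add_neg, e1, e2]
    tauto

theorem spinB_eq_of_flip {σ : Config} {k l : ℕ} {v : ℤ × ℤ}
    (h : spinB σ (k + 1) v ≠ spinB σ k v) (hl : k + 1 ≤ l) :
    spinB σ l v = spinB σ (k + 1) v := by
  have hs : stepB (spinB σ k) v = spinB σ (k + 1) v := by rw [spinB_succ]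
  obtain ⟨g, h1, h2⟩ := exists_face_of_stepB h.symm hs
  rw [← spinB_succ] at h1 h2
  exact (spinB_eq_of_face rfl h1 h2 hl).1

theorem flip_unique {σ : Config} {k l : ℕ} {v : ℤ × ℤ}
    (hk : spinB σ (k + 1) v ≠ spinB σ k v) (hl : spinB σ (l + 1) v ≠ spinB σ l v) : k = l := by
  wlog hkl : k ≤ l generalizing k l
  · exact (this hl hk (by omega)).symm
  by_contra hne
  exact hl (by rw [spinB_eq_of_flip hk (by omega : k + 1 ≤ l + 1),
    spinB_eq_of_flip hk (by omega : k + 1 ≤ l)])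

theorem spinB_eq_of_le_flip {σ : Config} {k l : ℕ} {v : ℤ × ℤ}
    (h : spinB σ (k + 1) v ≠ spinB σ k v) (hl : l ≤ k) : spinB σ l v = spinB σ k v := by
  have key : ∀ l, l ≤ k → spinB σ l v = spinB σ 0 v := by
    intro l hl
    induction l with
    | zero => rfl
    | succ l ih =>
      rw [← ih (by omega)]
      by_contra hne
      have := flip_unique h hne
      omega
  rw [key l hl, key k le_rfl]

/-! ### Lattice paths -/

/-- The endpoint of the path that starts at `x` and follows the word `w` of directions. Words are
written with the last step first. -/
def tip (x : ℤ × ℤ) : List (Fin 6) → ℤ × ℤ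
  | [] => x
  | h :: w => tip x w + dir h

/-- The sites visited by a path, its start included. -/
def pathSites (x : ℤ × ℤ) : List (Fin 6) → Finset (ℤ × ℤ)
  | [] => {x}
  | h :: w => insert (tip x w + dir h) (pathSites x w)

/-- The third vertices of the faces that contain the edges of a path. -/
def pathCorners (x : ℤ × ℤ) : List (Fin 6) → Finset (ℤ × ℤ)
  | [] => ∅
  | h :: w => insert (tip x w + dir (faceMate h)) (pathCorners x w)

/-- The path is induced: sites visited at least two steps apart are neither equal nor adjacent. -/
def IsInduced (x : ℤ × ℤ) : List (Fin 6) → Prop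
  | [] => True
  | [_] => True
  | h :: h' :: w => IsInduced x (h' :: w) ∧ ∀ u ∈ pathSites x w, ¬ Near (tip x (h :: h' :: w)) u

theorem tip_mem_pathSites (x : ℤ × ℤ) (w : List (Fin 6)) : tip x w ∈ pathSites x w := by
  cases w <;> simp [tip, pathSites]

theorem mem_pathSites_cons {x u : ℤ × ℤ} {h : Fin 6} {w : List (Fin 6)} :
    u ∈ pathSites x (h :: w) ↔ u = tip x (h :: w) ∨ u ∈ pathSites x w := by
  simp [pathSites, tip]

theorem IsInduced.of_cons {x : ℤ × ℤ} {h : Fin 6} {w : List (Fin 6)}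
    (hw : IsInduced x (h :: w)) : IsInduced x w := by
  cases w with
  | nil => trivial
  | cons h' w => exact hw.1

theorem IsInduced.of_append {x : ℤ × ℤ} {u w : List (Fin 6)} (hw : IsInduced x (u ++ w)) :
    IsInduced x w := by
  induction u with
  | nil => exact hw
  | cons h u ih => exact ih hw.of_cons

theorem near_of_sub {u v e : ℤ × ℤ} (h : u - v = e) (he : e = 0 ∨ ∃ g, e = dir g) : Near u v := by
  rcases he with rfl | ⟨g, rfl⟩
  · exact Or.inl (sub_eq_zero.1 h)
  · exact Or.inr ⟨g, by rw [← h]; abel⟩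

theorem dir_ne_zero (h : Fin 6) : dir h ≠ 0 := by
  revert h; decide

/-- An induced path goes straight on or turns by 60 degrees. -/
theorem IsInduced.turn {x : ℤ × ℤ} {h h' : Fin 6} {w : List (Fin 6)}
    (hw : IsInduced x (h :: h' :: w)) : h = h' ∨ h = faceMate h' ∨ h = starMate h' := by
  have key : ∀ h h' : Fin 6, (h = h' ∨ h = faceMate h' ∨ h = starMate h') ∨
      (dir h' + dir h = 0 ∨ ∃ g, dir h' + dir h = dir g) := by decide
  refine (key h h').resolve_right fun hn => ?_
  refine hw.2 _ (tip_mem_pathSites x w) (near_of_sub (e := dir h' + dir h) ?_ hn)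
  simp only [tip]
  abel

theorem IsInduced.tip_notMem {x : ℤ × ℤ} {h : Fin 6} {w : List (Fin 6)}
    (hw : IsInduced x (h :: w)) : tip x (h :: w) ∉ pathSites x w := by
  have hne : tip x (h :: w) ≠ tip x w := by
    simp only [tip, ne_eq, add_eq_left]
    exact dir_ne_zero h
  cases w with
  | nil => simpa [pathSites, tip] using dir_ne_zero h
  | cons h' w =>
    rw [mem_pathSites_cons, not_or]
    exact ⟨hne, fun hm => hw.2 _ hm (Or.inl rfl)⟩

theorem exists_edge_of_mem_pathCorners {x f : ℤ × ℤ} {w : List (Fin 6)}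
    (hf : f ∈ pathCorners x w) :
    ∃ p g, p ∈ pathSites x w ∧ p + dir g ∈ pathSites x w ∧ f = p + dir (faceMate g) := by
  induction w with
  | nil => simp [pathCorners] at hf
  | cons h w ih =>
    rw [pathCorners, Finset.mem_insert] at hf
    rcases hf with rfl | hf
    · exact ⟨tip x w, h, Finset.mem_insert_of_mem (tip_mem_pathSites x w),
        Finset.mem_insert_self _ _, rfl⟩
    · obtain ⟨p, g, h1, h2, h3⟩ := ih hf
      exact ⟨p, g, Finset.mem_insert_of_mem h1, Finset.mem_insert_of_mem h2, h3⟩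

/-- The corner of a new edge of an induced path is a new site, unless the path has just made two
60 degree turns around that corner. -/
theorem IsInduced.corner_notMem {x : ℤ × ℤ} {h h' : Fin 6} {w : List (Fin 6)}
    (hw : IsInduced x (h :: h' :: w))
    (hturn : ∀ g w', w = g :: w' → h' = faceMate g → h ≠ starMate h') :
    tip x (h' :: w) + dir (faceMate h) ∉ pathCorners x (h' :: w) := by
  intro hf
  have ht := hw.turn
  rw [pathCorners, Finset.mem_insert] at hf
  rcases hf with hf | hf
  · -- the previous edge
    have key : ∀ h h' : Fin 6, (h = h' ∨ h = faceMate h' ∨ h = starMate h') →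
        dir h' + dir (faceMate h) ≠ dir (faceMate h') := by decide
    refine key h h' ht ?_
    simp only [tip, add_assoc] at hf
    exact add_left_cancel hf
  · cases w with
    | nil => simp [pathCorners] at hf
    | cons g w =>
      rw [pathCorners, Finset.mem_insert] at hf
      rcases hf with hf | hf
      · -- the edge before the previous one
        have key : ∀ h h' g : Fin 6, (h = h' ∨ h = faceMate h' ∨ h = starMate h') →
            (h' = g ∨ h' = faceMate g ∨ h' = starMate g) →
            dir g + (dir h' + dir (faceMate h)) = dir (faceMate g) →
            h' = faceMate g ∧ h = starMate h' := by decide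
        have hh := key h h' g ht hw.1.turn (by
          simp only [tip, add_assoc] at hf
          exact add_left_cancel hf)
        exact hturn g w rfl hh.1 hh.2
      · -- all earlier edges: one of their ends would be too close to the new edge
        obtain ⟨p, k, hp, hp', hfk⟩ := exists_edge_of_mem_pathCorners hf
        have h1 : ∀ u ∈ pathSites x w, ¬ Near (tip x (h' :: g :: w)) u := hw.1.2
        have h2 : ∀ u ∈ pathSites x w, ¬ Near (tip x (h' :: g :: w) + dir h) u := fun u hu =>
          hw.2 u (Finset.mem_insert_of_mem hu)
        set c := tip x (h' :: g :: w)
        have e : c - p = dir (faceMate k) - dir (faceMate h) := by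
          rw [sub_eq_sub_iff_add_eq_add, hfk]
          abel
        have key : ∀ h k : Fin 6,
            ((dir (faceMate k) - dir (faceMate h) = 0 ∨
              ∃ g, dir (faceMate k) - dir (faceMate h) = dir g) ∨
             (dir (faceMate k) - dir (faceMate h) - dir k = 0 ∨
              ∃ g, dir (faceMate k) - dir (faceMate h) - dir k = dir g)) ∨
            ((dir (faceMate k) - dir (faceMate h) + dir h = 0 ∨
              ∃ g, dir (faceMate k) - dir (faceMate h) + dir h = dir g) ∨
             (dir (faceMate k) - dir (faceMate h) - dir k + dir h = 0 ∨
              ∃ g, dir (faceMate k) - dir (faceMate h) - dir k + dir h = dir g)) := by decide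
        rcases key h k with (hk | hk) | (hk | hk)
        · exact h1 p hp (near_of_sub e hk)
        · exact h1 _ hp' (near_of_sub (by rw [← e]; abel) hk)
        · exact h2 p hp (near_of_sub (by rw [← e]; abel) hk)
        · exact h2 _ hp' (near_of_sub (by rw [← e]; abel) hk)

/-! ### A late flip forces a long path -/

/-- If `v` did not flip at one update and flips at the next, then one of its stars has only just
become constant apart from `v`, owing to a flip of one of its sites. -/
theorem exists_flip_before {σ : Config} {k : ℕ} {v : ℤ × ℤ} {s t : ℤˣ} (hts : t ≠ s)
    (hv : spinB σ (k + 1) v = s) (hv' : spinB σ (k + 2) v = t) :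
    ∃ h, spinB σ k (v + dir h) = s ∧ spinB σ (k + 1) (v + dir h) = t ∧
      spinB σ (k + 1) (v + dir (starMate h)) = t := by
  by_contra hn
  have htwo : ∀ s t y : ℤˣ, t ≠ s → y ≠ t → y = s := by decide
  have hk : spinB σ k v = s := by
    by_contra hk
    have := flip_unique (σ := σ) (v := v) (k := k) (l := k + 1) (by rw [hv]; exact Ne.symm hk)
      (by rw [hv', hv]; exact hts)
    omega
  have hback : ∀ h, spinB σ (k + 1) (v + dir h) = t → spinB σ (k + 1) (v + dir (starMate h)) = t →
      spinB σ k (v + dir h) = t := fun h h1 h2 => by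
    by_contra h3
    exact hn ⟨h, htwo s t _ hts h3, h1, h2⟩
  have hpair : ∀ h, starMate (starMate h) = h →
      spinB σ (k + 1) (v + dir h) = t ∧ spinB σ (k + 1) (v + dir (starMate h)) = t →
      spinB σ k (v + dir h) = t ∧ spinB σ k (v + dir (starMate h)) = t := fun h hh h1 =>
    ⟨hback h h1.1 h1.2, hback (starMate h) h1.2 (by rw [hh]; exact h1.1)⟩
  have p0 := hpair 0 rfl
  have p2 := hpair 2 rfl
  have p4 := hpair 4 rfl
  rw [spinB_succ, stepB_eq_iff_of_ne _ _ hts hv] at hv'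
  have hs : stepB (spinB σ k) v = t := by
    rw [stepB_eq_iff_of_ne _ _ hts hk]
    rcases hv' with ⟨h1, h2⟩ | ⟨h1, h2⟩ | ⟨h1, h2⟩
    · exact Or.inl ⟨p0 h1, p2 h2⟩
    · exact Or.inr (Or.inl ⟨p2 h1, p4 h2⟩)
    · exact Or.inr (Or.inr ⟨p0 h1, p4 h2⟩)
  rw [← spinB_succ, hv] at hs
  exact hts hs.symm

/-- When a site flips, two neighbours with the old spin lie in the same star. -/
theorem eq_starMate_of_flip {σ : Config} {k : ℕ} {v : ℤ × ℤ} {s t : ℤˣ} (hts : t ≠ s)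
    (hv : spinB σ k v = s) (hv' : spinB σ (k + 1) v = t) {g h : Fin 6} (hgh : g ≠ h)
    (hg : spinB σ k (v + dir g) = s) (hh : spinB σ k (v + dir h) = s) : g = starMate h := by
  rw [spinB_succ, stepB_eq_iff_of_ne _ _ hts hv] at hv'
  have hst := hts.symm
  fin_cases g <;> fin_cases h <;> first | rfl | exact absurd rfl hgh | (exfalso; simp_all)

/-- Following backwards in time the flips that caused a flip at `x`: there is an induced path from
`x`, with as many steps as wanted up to time `0`, whose sites flip one after the other towards
`x`. -/
theorem exists_induced_path_of_flip {σ : Config} {x : ℤ × ℤ} {s t : ℤˣ} (hts : t ≠ s) (n : ℕ) :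
    ∀ m, spinB σ (m + n) x = s → spinB σ (m + n + 1) x = t →
      ∃ w : List (Fin 6), w.length = n ∧ IsInduced x w ∧
        spinB σ m (tip x w) = s ∧ spinB σ (m + 1) (tip x w) = t ∧
        (∀ u ∈ pathSites x w, u = tip x w ∨ ∀ j ≤ m + 1, spinB σ j u = s) ∧
        ∀ u ∈ pathSites x w, ∃ j, spinB σ j u ≠ s := by
  induction n with
  | zero =>
    intro m h1 h2
    refine ⟨[], rfl, trivial, h1, h2, fun u hu => Or.inl (by simpa [pathSites, tip] using hu), ?_⟩
    intro u hu
    obtain rfl : u = x := by simpa [pathSites] using hu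
    exact ⟨m + 1, by rw [show m + 1 = m + 0 + 1 by ring, h2]; exact hts⟩
  | succ n ih =>
    intro m h1 h2
    rw [show m + (n + 1) = m + 1 + n by ring] at h1 h2
    obtain ⟨w, hlen, hind, hv, hv', hold, hfin⟩ := ih (m + 1) h1 h2
    obtain ⟨h, hu, hu', hd⟩ := exists_flip_before hts hv hv'
    have hvj : ∀ j ≤ m + 1, spinB σ j (tip x w) = s := fun j hj => by
      rw [spinB_eq_of_le_flip (k := m + 1) (by rw [hv', hv]; exact hts) hj, hv]
    have hall : ∀ y ∈ pathSites x w, ∀ j ≤ m + 1, spinB σ j y = s := fun y hy j hj => by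
      rcases hold y hy with rfl | hy'
      · exact hvj j hj
      · exact hy' j (by omega)
    refine ⟨h :: w, by simp [hlen], ?_, hu, hu', ?_, ?_⟩
    · cases w with
      | nil => trivial
      | cons h' w =>
        refine ⟨hind, fun y hy hnear => ?_⟩
        have hy1 := hall y (Finset.mem_insert_of_mem hy)
        have hyv : y ≠ tip x (h' :: w) := by
          rintro rfl
          exact hind.tip_notMem hy
        rcases hnear with rfl | ⟨g, hg⟩
        · exact hts (hu'.symm.trans (hy1 _ le_rfl))
        · -- `y` and the previous site share a star with the new site, as both still have spin `s`
          -- when the new site flips. But the third site of that star had to have the spin `t` for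
          -- the previous site to flip, while `y` flips only later.
          have hopp : ∀ h : Fin 6, ∃ h', -dir h = dir h' ∧ ∀ g, g ≠ h' →
              (g = starMate h' → dir h + dir g = dir (starMate h)) := by decide
          have hneg : ∀ g : Fin 6, ∃ g', -dir g = dir g' := by decide
          obtain ⟨h'', hh'', hmate⟩ := hopp h
          obtain ⟨g', hg'⟩ := hneg g
          have ey : y = tip x (h :: h' :: w) + dir g' := by
            rw [← hg', hg, add_neg_cancel_right]
          have ev : tip x (h' :: w) = tip x (h :: h' :: w) + dir h'' := by
            rw [← hh'']
            simp only [tip]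
            abel
          have hne : g' ≠ h'' := by
            rintro rfl
            exact hyv (ey.trans ev.symm)
          have hg1 : g' = starMate h'' := eq_starMate_of_flip hts hu hu' hne
            (by
              have := hy1 m (by omega)
              rwa [ey] at this)
            (by
              have := hvj m (by omega)
              rwa [ev] at this)
          have ey' : y = tip x (h' :: w) + dir (starMate h) := by
            rw [ey, ← hmate g' hne hg1]
            simp only [tip]
            abel
          rw [← ey', hy1 _ le_rfl] at hd
          exact hts hd.symm
    · intro u hu1
      rcases mem_pathSites_cons.1 hu1 with h3 | h3
      · exact Or.inl h3
      · exact Or.inr (hall u h3)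
    · intro u hu1
      rcases mem_pathSites_cons.1 hu1 with rfl | h3
      · exact ⟨m + 1, by rw [tip, hu']; exact hts⟩
      · exact hfin u h3

/-- Initial configurations with spin `s` on `M` and `-s` on `P`, two sets of `ℬ`-sites. -/
def prescribed (s : ℤˣ) (M P : Finset (ℤ × ℤ)) : Set Config :=
  {σ | (∀ u ∈ M, σ (.B u.1 u.2) = s) ∧ ∀ u ∈ P, σ (.B u.1 u.2) = -s}

/-- A flip at the `(k + 1)`-st update of `ℬ` needs `k` steps of an induced path of equal initial
spins, none of whose edges lies in a constant face. -/
theorem exists_mem_prescribed_of_flip {σ : Config} {x : ℤ × ℤ} {k n : ℕ} (hn : n ≤ k)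
    (h : spinB σ (k + 1) x ≠ spinB σ k x) :
    ∃ s, ∃ w : List (Fin 6), w.length = n ∧ IsInduced x w ∧
      σ ∈ prescribed s (pathSites x w) (pathCorners x w) := by
  obtain ⟨m, rfl⟩ := Nat.exists_eq_add_of_le' hn
  obtain ⟨w, hlen, hind, hv, hv', hold, hfin⟩ :=
    exists_induced_path_of_flip (x := x) h n m rfl rfl
  set s := spinB σ (m + n) x
  have hall : ∀ u ∈ pathSites x w, spinB σ 0 u = s := fun u hu => by
    rcases hold u hu with rfl | hu'
    · rw [spinB_eq_of_le_flip (k := m) (by rw [hv', hv]; exact h) (Nat.zero_le m), hv]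
    · exact hu' 0 (Nat.zero_le _)
  refine ⟨s, w, hlen, hind, hall, fun f hf => ?_⟩
  obtain ⟨p, g, hp, hp', rfl⟩ := exists_edge_of_mem_pathCorners hf
  have hneg : ∀ y s : ℤˣ, y ≠ s → y = -s := by decide
  refine hneg _ _ fun hfs => ?_
  obtain ⟨j, hj⟩ := hfin p hp
  exact hj (spinB_eq_of_face (hall p hp) (hall _ hp') hfs (Nat.zero_le j)).1

/-! ### Probability of prescribed initial spins -/

instance : MeasurableSingletonClass ℤˣ :=
  ⟨fun s => ⟨{(s : ℤ)}, measurableSet_singleton _, by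
    ext y
    simp [Units.ext_iff]⟩⟩

/-- The probability that a given site has initial spin `s`. -/
noncomputable def spinProb (p : unitInterval) (s : ℤˣ) : ℝ :=
  (bernoulliMeasure (1 : ℤˣ) (-1) p).real {s}

theorem spinProb_nonneg (p : unitInterval) (s : ℤˣ) : 0 ≤ spinProb p s := measureReal_nonneg

theorem spinProb_add_spinProb_neg (p : unitInterval) (s : ℤˣ) :
    spinProb p s + spinProb p (-s) = 1 := by
  have huniv : ∀ s : ℤˣ, ({s} : Set ℤˣ) ∪ {-s} = Set.univ := fun s => by
    ext y
    revert s y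
    simp only [Set.mem_union, Set.mem_singleton_iff, Set.mem_univ, iff_true]
    decide
  have hne : ∀ s : ℤˣ, s ≠ -s := by decide
  rw [spinProb, spinProb, ← measureReal_union (by simp [hne s]) (measurableSet_singleton _),
    huniv, probReal_univ]

instance (p : unitInterval) : IsProbabilityMeasure (initialLaw p) := by
  rw [initialLaw]
  infer_instance

theorem prescribed_eq_pi {s : ℤˣ} {M P : Finset (ℤ × ℤ)} (h : Disjoint M P) :
    prescribed s M P = Set.pi ↑((M ∪ P).image fun u => Site.B u.1 u.2)
      (fun x => {if x ∈ M.image (fun u => Site.B u.1 u.2) then s else -s}) := by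
  ext σ
  have hM : ∀ u : ℤ × ℤ, Site.B u.1 u.2 ∈ M.image (fun u => Site.B u.1 u.2) ↔ u ∈ M := by
    intro u
    simp
  simp only [prescribed, Set.mem_ofPred_eq, Set.mem_pi, Finset.coe_image, Set.forall_mem_image,
    Finset.coe_union, Set.mem_union, Finset.mem_coe, Set.mem_singleton_iff, hM]
  constructor
  · rintro ⟨h1, h2⟩ u hu
    by_cases hu' : u ∈ M
    · simp only [hu', if_true]
      exact h1 u hu'
    · simp only [hu', if_false]
      exact h2 u (hu.resolve_left hu')
  · intro h3
    refine ⟨fun u hu => ?_, fun u hu => ?_⟩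
    · simpa [hu] using h3 (x := u) (Or.inl hu)
    · simpa [Finset.disjoint_right.1 h hu] using h3 (x := u) (Or.inr hu)

theorem measurableSet_prescribed {s : ℤˣ} {M P : Finset (ℤ × ℤ)} (h : Disjoint M P) :
    MeasurableSet (prescribed s M P) := by
  rw [prescribed_eq_pi h]
  exact MeasurableSet.pi (Finset.countable_toSet _) fun _ _ => measurableSet_singleton _

theorem initialLaw_prescribed (p : unitInterval) {s : ℤˣ} {M P : Finset (ℤ × ℤ)}
    (h : Disjoint M P) :
    (initialLaw p).real (prescribed s M P) =
      spinProb p s ^ M.card * spinProb p (-s) ^ P.card := by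
  have hinj : Function.Injective fun u : ℤ × ℤ => Site.B u.1 u.2 := fun u v huv => by
    simpa [Prod.ext_iff] using huv
  have hM : ∀ u : ℤ × ℤ, Site.B u.1 u.2 ∈ M.image (fun u => Site.B u.1 u.2) ↔ u ∈ M := by
    intro u
    simp
  rw [prescribed_eq_pi h, measureReal_def, initialLaw,
    Measure.infinitePi_pi _ fun _ _ => measurableSet_singleton _, ENNReal.toReal_prod,
    Finset.prod_image hinj.injOn, Finset.prod_union h]
  congr 1
  · rw [← Finset.prod_const]
    refine Finset.prod_congr rfl fun u hu => ?_
    rw [if_pos ((hM u).2 hu)]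
    rfl
  · rw [← Finset.prod_const]
    refine Finset.prod_congr rfl fun u hu => ?_
    rw [if_neg fun hu' => Finset.disjoint_right.1 h hu ((hM u).1 hu')]
    rfl

theorem prescribed_eq_empty {s : ℤˣ} {M P : Finset (ℤ × ℤ)} (h : ¬ Disjoint M P) :
    prescribed s M P = ∅ := by
  obtain ⟨u, hM, hP⟩ := Finset.not_disjoint_iff.1 h
  refine Set.eq_empty_of_forall_notMem fun σ hσ => ?_
  have hne : ∀ s : ℤˣ, s ≠ -s := by decide
  exact hne s ((hσ.1 u hM).symm.trans (hσ.2 u hP))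

theorem initialLaw_prescribed_insert_left (p : unitInterval) {s : ℤˣ} {M P : Finset (ℤ × ℤ)}
    {u : ℤ × ℤ} (hu : u ∉ M) :
    (initialLaw p).real (prescribed s (insert u M) P) ≤
      spinProb p s * (initialLaw p).real (prescribed s M P) := by
  by_cases h : Disjoint (insert u M) P
  · rw [initialLaw_prescribed p h, initialLaw_prescribed p (Finset.disjoint_insert_left.1 h).2,
      Finset.card_insert_of_notMem hu]
    exact (by ring : _ = _).le
  · rw [prescribed_eq_empty h, measureReal_empty]
    exact mul_nonneg (spinProb_nonneg p s) measureReal_nonneg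

theorem initialLaw_prescribed_insert_right (p : unitInterval) {s : ℤˣ} {M P : Finset (ℤ × ℤ)}
    {u : ℤ × ℤ} (hu : u ∉ P) :
    (initialLaw p).real (prescribed s M (insert u P)) ≤
      spinProb p (-s) * (initialLaw p).real (prescribed s M P) := by
  by_cases h : Disjoint M (insert u P)
  · rw [initialLaw_prescribed p h, initialLaw_prescribed p (Finset.disjoint_insert_right.1 h).2,
      Finset.card_insert_of_notMem hu]
    exact (by ring : _ = _).le
  · rw [prescribed_eq_empty h, measureReal_empty]
    exact mul_nonneg (spinProb_nonneg p _) measureReal_nonneg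

/-! ### The weighted count of paths -/

/-- The event that the path with word `w` has an induced extension by `n` more steps, along which
the initial spins are `s` on the sites and `-s` on the corners. -/
def extensionEvent (s : ℤˣ) (x : ℤ × ℤ) (w : List (Fin 6)) (n : ℕ) : Set Config :=
  {σ | ∃ u : List (Fin 6), u.length = n ∧ IsInduced x (u ++ w) ∧
    σ ∈ prescribed s (pathSites x (u ++ w)) (pathCorners x (u ++ w))}

theorem prescribed_mono {s : ℤˣ} {M M' P P' : Finset (ℤ × ℤ)} (hM : M ⊆ M') (hP : P ⊆ P') :
    prescribed s M' P' ⊆ prescribed s M P :=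
  fun _ hσ => ⟨fun u hu => hσ.1 u (hM hu), fun u hu => hσ.2 u (hP hu)⟩

theorem extensionEvent_succ {s : ℤˣ} {x : ℤ × ℤ} {w : List (Fin 6)} {n : ℕ} {σ : Config}
    (hσ : σ ∈ extensionEvent s x w (n + 1)) :
    ∃ h, IsInduced x (h :: w) ∧ σ ∈ extensionEvent s x (h :: w) n := by
  obtain ⟨u, hlen, hu⟩ := hσ
  have hne : u ≠ [] := by
    rintro rfl
    simp at hlen
  rw [← List.dropLast_append_getLast hne, List.append_assoc, List.singleton_append] at hu
  exact ⟨u.getLast hne, hu.1.of_append, u.dropLast, by simp [hlen], hu⟩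

theorem extensionEvent_eq_empty {s : ℤˣ} {x : ℤ × ℤ} {w : List (Fin 6)} (n : ℕ)
    (hw : ¬ IsInduced x w) : extensionEvent s x w n = ∅ :=
  Set.eq_empty_of_forall_notMem fun _ ⟨_, _, hu, _⟩ => hw hu.of_append

/-- A potential for the weighted count of paths: a path whose last turn was around the corner of
the edge before it may reuse that corner, and weighs more. -/
noncomputable def potential : List (Fin 6) → ℝ
  | h :: g :: _ => if h = faceMate g then 3 / 2 else 1
  | _ => 1

theorem one_le_potential (w : List (Fin 6)) : 1 ≤ potential w := by
  unfold potential
  split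
  · split_ifs <;> norm_num
  · exact le_rfl

theorem faceMate_ne (h : Fin 6) : faceMate h ≠ h := by
  revert h; decide

theorem starMate_ne_faceMate (h : Fin 6) : starMate h ≠ faceMate h := by
  revert h; decide

theorem initialLaw_prescribed_path_cons_le (p : unitInterval) {s : ℤˣ} {x : ℤ × ℤ} {h : Fin 6}
    {w : List (Fin 6)} (hw : IsInduced x (h :: w)) :
    (initialLaw p).real (prescribed s (pathSites x (h :: w)) (pathCorners x (h :: w))) ≤
      spinProb p s * (initialLaw p).real (prescribed s (pathSites x w) (pathCorners x w)) :=
  (measureReal_mono (prescribed_mono le_rfl (Finset.subset_insert _ _))).trans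
    (initialLaw_prescribed_insert_left p hw.tip_notMem)

theorem initialLaw_prescribed_path_cons_le_of_turn (p : unitInterval) {s : ℤˣ} {x : ℤ × ℤ}
    {h h' : Fin 6} {w : List (Fin 6)} (hw : IsInduced x (h :: h' :: w))
    (hturn : ∀ g w', w = g :: w' → h' = faceMate g → h ≠ starMate h') :
    (initialLaw p).real
        (prescribed s (pathSites x (h :: h' :: w)) (pathCorners x (h :: h' :: w))) ≤
      spinProb p s * spinProb p (-s) *
        (initialLaw p).real (prescribed s (pathSites x (h' :: w)) (pathCorners x (h' :: w))) := by
  refine (initialLaw_prescribed_insert_left p hw.tip_notMem).trans ?_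
  rw [mul_assoc]
  exact mul_le_mul_of_nonneg_left
    (initialLaw_prescribed_insert_right p (hw.corner_notMem hturn)) (spinProb_nonneg p s)

/-- The weights of the three possible next steps, multiplied by the potential, add up to at most
`7 / 8` times the potential, whatever the density. -/
theorem initialLaw_extensionEvent_le (p : unitInterval) (s : ℤˣ) (x : ℤ × ℤ) (n : ℕ) :
    ∀ (h' : Fin 6) (w : List (Fin 6)),
      (initialLaw p).real (extensionEvent s x (h' :: w) n) ≤
        potential (h' :: w) * (7 / 8) ^ n *
          (initialLaw p).real
            (prescribed s (pathSites x (h' :: w)) (pathCorners x (h' :: w))) := by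
  induction n with
  | zero =>
    intro h' w
    rw [pow_zero, mul_one]
    refine le_trans (measureReal_mono ?_)
      (le_mul_of_one_le_left measureReal_nonneg (one_le_potential _))
    rintro σ ⟨u, hu, -, hσ⟩
    obtain rfl := List.length_eq_zero_iff.1 hu
    exact hσ
  | succ n ih =>
    intro h' w
    set q := spinProb p s
    set r := spinProb p (-s)
    have hqr : q + r = 1 := spinProb_add_spinProb_neg p s
    have hq0 : 0 ≤ q := spinProb_nonneg p s
    have hr0 : 0 ≤ r := spinProb_nonneg p (-s)
    set Z := (initialLaw p).real (prescribed s (pathSites x (h' :: w)) (pathCorners x (h' :: w)))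
    have hZ0 : 0 ≤ Z := measureReal_nonneg
    have hpow : (0 : ℝ) ≤ (7 / 8) ^ n := by positivity
    have hpot : ∀ w, 0 ≤ potential w := fun w => zero_le_one.trans (one_le_potential w)
    have hstep : ∀ (h : Fin 6) (c : ℝ), 0 ≤ c →
        (IsInduced x (h :: h' :: w) →
          (initialLaw p).real
            (prescribed s (pathSites x (h :: h' :: w)) (pathCorners x (h :: h' :: w))) ≤ c * Z) →
        (initialLaw p).real (extensionEvent s x (h :: h' :: w) n) ≤
          potential (h :: h' :: w) * c * ((7 / 8) ^ n * Z) := by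
      intro h c hc hle
      by_cases hind : IsInduced x (h :: h' :: w)
      · refine (ih h (h' :: w)).trans ?_
        refine (mul_le_mul_of_nonneg_left (hle hind) (mul_nonneg (hpot _) hpow)).trans ?_
        exact (by ring : _ = _).le
      · rw [extensionEvent_eq_empty n hind, measureReal_empty]
        exact mul_nonneg (mul_nonneg (hpot _) hc) (mul_nonneg hpow hZ0)
    have hsub : extensionEvent s x (h' :: w) (n + 1) ⊆
        extensionEvent s x (h' :: h' :: w) n ∪
          (extensionEvent s x (faceMate h' :: h' :: w) n ∪
            extensionEvent s x (starMate h' :: h' :: w) n) := by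
      intro σ hσ
      obtain ⟨h, hind, hσ'⟩ := extensionEvent_succ hσ
      rcases hind.turn with rfl | rfl | rfl
      · exact Or.inl hσ'
      · exact Or.inr (Or.inl hσ')
      · exact Or.inr (Or.inr hσ')
    have hunion := (measureReal_mono (μ := initialLaw p) hsub).trans
      ((measureReal_union_le _ _).trans
        (add_le_add_right (measureReal_union_le _ _) _))
    have hstar : ∀ h : Fin 6, h ≠ starMate h := by decide
    have hface : ∀ h : Fin 6, faceMate h ≠ starMate h := by decide
    have h1 := hstep h' (q * r) (by positivity) fun hind =>
      initialLaw_prescribed_path_cons_le_of_turn p hind fun _ _ _ _ => hstar h'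
    have h2 := hstep (faceMate h') (q * r) (by positivity) fun hind =>
      initialLaw_prescribed_path_cons_le_of_turn p hind fun _ _ _ _ => hface h'
    have p1 : potential (h' :: h' :: w) = 1 := if_neg (faceMate_ne h').symm
    have p2 : potential (faceMate h' :: h' :: w) = 3 / 2 := if_pos rfl
    have p3 : potential (starMate h' :: h' :: w) = 1 := if_neg (starMate_ne_faceMate h')
    rw [p1] at h1
    rw [p2] at h2
    have hw0 : 0 ≤ (7 / 8 : ℝ) ^ n * Z := mul_nonneg hpow hZ0
    have hr' : r = 1 - q := by linarith
    by_cases hturn : ∀ g w', w = g :: w' → h' ≠ faceMate g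
    · have h3 := hstep (starMate h') (q * r) (by positivity) fun hind =>
        initialLaw_prescribed_path_cons_le_of_turn p hind fun g w' hw hg =>
          absurd hg (hturn g w' hw)
      rw [p3] at h3
      have hnum : 1 * (q * r) + (3 / 2 * (q * r) + 1 * (q * r)) ≤ 7 / 8 := by
        rw [hr']
        nlinarith [sq_nonneg (q - 1 / 2)]
      calc _ ≤ _ := hunion
        _ ≤ (1 * (q * r) + (3 / 2 * (q * r) + 1 * (q * r))) * ((7 / 8) ^ n * Z) := by linarith
        _ ≤ 7 / 8 * ((7 / 8) ^ n * Z) := mul_le_mul_of_nonneg_right hnum hw0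
        _ = 1 * (7 / 8) ^ (n + 1) * Z := by ring
        _ ≤ _ := mul_le_mul_of_nonneg_right
          (mul_le_mul_of_nonneg_right (one_le_potential _) (by positivity)) hZ0
    · push Not at hturn
      obtain ⟨g, w', rfl, hg⟩ := hturn
      -- this turn may reuse a corner, so only the new site is paid for
      have h3 := hstep (starMate h') q hq0 fun hind => initialLaw_prescribed_path_cons_le p hind
      rw [p3] at h3
      have hnum : 1 * (q * r) + (3 / 2 * (q * r) + 1 * q) ≤ 7 / 8 * (3 / 2) := by
        rw [hr']
        nlinarith [sq_nonneg (q - 7 / 10)]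
      calc _ ≤ _ := hunion
        _ ≤ (1 * (q * r) + (3 / 2 * (q * r) + 1 * q)) * ((7 / 8) ^ n * Z) := by linarith
        _ ≤ 7 / 8 * (3 / 2) * ((7 / 8) ^ n * Z) := mul_le_mul_of_nonneg_right hnum hw0
        _ = 3 / 2 * (7 / 8) ^ (n + 1) * Z := by ring
        _ = _ := by rw [show potential (h' :: g :: w') = 3 / 2 from if_pos hg]

theorem initialLaw_extensionEvent_nil_le (p : unitInterval) (s : ℤˣ) (x : ℤ × ℤ) (n : ℕ) :
    (initialLaw p).real (extensionEvent s x [] n) ≤ 7 * (7 / 8) ^ n := by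
  cases n with
  | zero => exact measureReal_le_one.trans (by norm_num)
  | succ n =>
    have hsub : extensionEvent s x [] (n + 1) ⊆ ⋃ h, extensionEvent s x [h] n := fun σ hσ => by
      obtain ⟨h, -, hσ'⟩ := extensionEvent_succ hσ
      exact Set.mem_iUnion.2 ⟨h, hσ'⟩
    calc _ ≤ _ := measureReal_mono hsub
      _ ≤ ∑ h, (initialLaw p).real (extensionEvent s x [h] n) := measureReal_iUnion_fintype_le _
      _ ≤ ∑ _h : Fin 6, (7 / 8 : ℝ) ^ n := Finset.sum_le_sum fun h _ => by
        refine (initialLaw_extensionEvent_le p s x n h []).trans ?_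
        rw [show potential [h] = 1 from rfl, one_mul]
        exact mul_le_of_le_one_right (by positivity) measureReal_le_one
      _ = 6 * (7 / 8) ^ n := by simp
      _ ≤ 7 * (7 / 8) ^ (n + 1) := by
        rw [pow_succ]
        nlinarith [pow_nonneg (by norm_num : (0 : ℝ) ≤ 7 / 8) n]

/-! ### Exponential decay -/

theorem initialLaw_flipsAfter_B_le (p : unitInterval) (i j : ℤ) (n : ℕ) :
    (initialLaw p).real {σ | FlipsAfter σ (.B i j) n} ≤ 14 * (7 / 8) ^ (n / 2) := by
  have hsub : {σ | FlipsAfter σ (.B i j) n} ⊆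
      extensionEvent 1 (i, j) [] (n / 2) ∪ extensionEvent (-1) (i, j) [] (n / 2) := by
    rintro σ ⟨m, hm, hflip⟩
    obtain ⟨k, rfl, hk⟩ := (flipsAtStep_B_iff σ i j m).1 hflip
    obtain ⟨s, w, hlen, hind, hσ⟩ :=
      exists_mem_prescribed_of_flip (n := n / 2) (by omega) hk
    have hmem : σ ∈ extensionEvent s (i, j) [] (n / 2) :=
      ⟨w, hlen, by rwa [List.append_nil], by rwa [List.append_nil]⟩
    rcases Int.units_eq_one_or s with rfl | rfl
    · exact Or.inl hmem
    · exact Or.inr hmem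
  calc _ ≤ _ := (measureReal_mono hsub).trans (measureReal_union_le _ _)
    _ ≤ 7 * (7 / 8) ^ (n / 2) + 7 * (7 / 8) ^ (n / 2) :=
      add_le_add (initialLaw_extensionEvent_nil_le p _ _ _)
        (initialLaw_extensionEvent_nil_le p _ _ _)
    _ = _ := by ring

theorem initialLaw_flipsAfter_succ_le (p : unitInterval) (x : Site) (n : ℕ) :
    (initialLaw p).real {σ | FlipsAfter σ x (n + 1)} ≤ 42 * (7 / 8) ^ (n / 2) := by
  cases x with
  | A i j =>
    have hsub : {σ | FlipsAfter σ (.A i j) (n + 1)} ⊆ {σ | FlipsAfter σ (.B i j) n} ∪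
        ({σ | FlipsAfter σ (.B (i + 1) j) n} ∪ {σ | FlipsAfter σ (.B i (j + 1)) n}) := by
      rintro σ ⟨m, hm, hflip⟩
      obtain ⟨m, rfl⟩ := Nat.exists_eq_add_of_le' (show 1 ≤ m by omega)
      rcases flipsAtStep_A_succ hflip with h | h | h
      · exact Or.inl ⟨m, by omega, h⟩
      · exact Or.inr (Or.inl ⟨m, by omega, h⟩)
      · exact Or.inr (Or.inr ⟨m, by omega, h⟩)
    have h0 := initialLaw_flipsAfter_B_le p i j n
    have h1 := initialLaw_flipsAfter_B_le p (i + 1) j n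
    have h2 := initialLaw_flipsAfter_B_le p i (j + 1) n
    have h3 := (measureReal_mono (μ := initialLaw p) hsub).trans (measureReal_union_le _ _)
    have h4 := measureReal_union_le (μ := initialLaw p)
      {σ | FlipsAfter σ (.B (i + 1) j) n} {σ | FlipsAfter σ (.B i (j + 1)) n}
    linarith
  | B i j =>
    have hsub : {σ | FlipsAfter σ (.B i j) (n + 1)} ⊆ {σ | FlipsAfter σ (.B i j) n} := by
      rintro σ ⟨m, hm, hflip⟩
      exact ⟨m, by omega, hflip⟩
    have h0 := (measureReal_mono (μ := initialLaw p) hsub).trans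
      (initialLaw_flipsAfter_B_le p i j n)
    have h1 : (0 : ℝ) ≤ (7 / 8) ^ (n / 2) := by positivity
    linarith

/-- One of the faces at the `ℬ`-site `v`. -/
def faceAt (v : ℤ × ℤ) : Finset (ℤ × ℤ) := {v, v + dir 1, v + dir (faceMate 1)}

theorem not_flipsAtStep_of_face {σ : Config} {s : ℤˣ} {i j : ℤ}
    (h : ∀ u ∈ faceAt (i, j), σ (.B u.1 u.2) = s) (m : ℕ) : ¬ FlipsAtStep σ (.B i j) m := by
  rw [flipsAtStep_B_iff]
  rintro ⟨k, -, hk⟩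
  have hconst : ∀ l, spinB σ l (i, j) = s := fun l =>
    (spinB_eq_of_face (k := 0) (h := 1) (h _ (by simp [faceAt])) (h _ (by simp [faceAt]))
      (h _ (by simp [faceAt])) (Nat.zero_le l)).1
  exact hk ((hconst _).trans (hconst _).symm)

/-- At most nine `ℬ`-sites that, if their initial spins agree, keep `x` from flipping after
time `1`. -/
def guard : Site → Finset (ℤ × ℤ)
  | .A i j => faceAt (i, j) ∪ (faceAt (i + 1, j) ∪ faceAt (i, j + 1))
  | .B i j => faceAt (i, j)

theorem card_guard_le (x : Site) : (guard x).card ≤ 9 := by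
  have h3 : ∀ v, (faceAt v).card ≤ 3 := fun v => Finset.card_le_three
  cases x with
  | A i j =>
    have h1 := Finset.card_union_le (faceAt (i, j)) (faceAt (i + 1, j) ∪ faceAt (i, j + 1))
    have h2 := Finset.card_union_le (faceAt (i + 1, j)) (faceAt (i, j + 1))
    have e0 := h3 (i, j)
    have e1 := h3 (i + 1, j)
    have e2 := h3 (i, j + 1)
    rw [guard]
    omega
  | B i j => exact (h3 (i, j)).trans (by norm_num)

theorem not_flipsAfter_of_guard {σ : Config} {s : ℤˣ} {x : Site}
    (h : ∀ u ∈ guard x, σ (.B u.1 u.2) = s) : ¬ FlipsAfter σ x 1 := by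
  rintro ⟨m, hm, hflip⟩
  cases x with
  | A i j =>
    obtain ⟨m, rfl⟩ := Nat.exists_eq_add_of_le' hm
    simp only [guard, Finset.mem_union] at h
    rcases flipsAtStep_A_succ hflip with h' | h' | h'
    · exact not_flipsAtStep_of_face (fun u hu => h u (Or.inl hu)) m h'
    · exact not_flipsAtStep_of_face (fun u hu => h u (Or.inr (Or.inl hu))) m h'
    · exact not_flipsAtStep_of_face (fun u hu => h u (Or.inr (Or.inr hu))) m h'
  | B i j => exact not_flipsAtStep_of_face h m hflip

/-- The guard of `x` shows the more likely of the two spins with probability at least `2⁻⁹`. -/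
theorem initialLaw_flipsAfter_one_le (p : unitInterval) (x : Site) :
    (initialLaw p).real {σ | FlipsAfter σ x 1} ≤ 1 - (1 / 2) ^ 9 := by
  obtain ⟨s, hs⟩ : ∃ s, 1 / 2 ≤ spinProb p s := by
    by_contra! hs
    linarith [hs 1, hs (-1), spinProb_add_spinProb_neg p 1]
  have hsub : {σ | FlipsAfter σ x 1} ⊆ (prescribed s (guard x) ∅)ᶜ :=
    fun σ hσ hσ' => not_flipsAfter_of_guard hσ'.1 hσ
  have hdisj : Disjoint (guard x) ∅ := Finset.disjoint_empty_right _
  have hle : (1 / 2 : ℝ) ^ 9 ≤ (initialLaw p).real (prescribed s (guard x) ∅) := by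
    rw [initialLaw_prescribed p hdisj, Finset.card_empty, pow_zero, mul_one]
    calc (1 / 2 : ℝ) ^ 9 ≤ (1 / 2) ^ (guard x).card :=
          pow_le_pow_of_le_one (by norm_num) (by norm_num) (card_guard_le x)
      _ ≤ _ := pow_le_pow_left₀ (by norm_num) hs _
  calc _ ≤ _ := measureReal_mono hsub
    _ = 1 - (initialLaw p).real (prescribed s (guard x) ∅) :=
      probReal_compl_eq_one_sub (measurableSet_prescribed hdisj)
    _ ≤ _ := by linarith

/-- The bound from the path count takes over at `n = 132`; below that, the probability is only
known to be at most `1 - 2⁻⁹`, which determines the rate. -/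
theorem initialLaw_flipsAfter_le_exp (p : unitInterval) (x : Site) (n : ℕ) :
    (initialLaw p).real {σ | FlipsAfter σ x n} ≤ Real.exp (-((1 / 2) ^ 9 / 132 * n)) := by
  have hexp : ∀ y : ℝ, 1 - y ≤ Real.exp (-y) := fun y => by
    linarith [Real.add_one_le_exp (-y)]
  rcases Nat.eq_zero_or_pos n with rfl | hn
  · simp
  have hn1 : (1 : ℝ) ≤ n := by exact_mod_cast hn
  rcases le_total n 132 with hle | hge
  · have hn2 : (n : ℝ) ≤ 132 := by exact_mod_cast hle
    have hsub : {σ | FlipsAfter σ x n} ⊆ {σ | FlipsAfter σ x 1} := by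
      rintro σ ⟨m, hm, hflip⟩
      exact ⟨m, by omega, hflip⟩
    calc _ ≤ _ := measureReal_mono hsub
      _ ≤ _ := initialLaw_flipsAfter_one_le p x
      _ ≤ _ := hexp _
      _ ≤ _ := Real.exp_le_exp.2 (by linarith)
  · have hn2 : (132 : ℝ) ≤ n := by exact_mod_cast hge
    obtain ⟨m, rfl⟩ := Nat.exists_eq_add_of_le' hn
    have hm : ((m : ℝ) - 1) / 2 ≤ ((m / 2 : ℕ) : ℝ) := by
      have : m ≤ 2 * (m / 2) + 1 := by omega
      have : (m : ℝ) ≤ 2 * ((m / 2 : ℕ) : ℝ) + 1 := by exact_mod_cast this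
      linarith
    have h42 : (42 : ℝ) ≤ Real.exp 4 := by
      have h1 : Real.exp 4 = Real.exp 1 ^ 4 := by
        rw [← Real.exp_nat_mul]
        norm_num
      rw [h1]
      calc (42 : ℝ) ≤ 2.7 ^ 4 := by norm_num
        _ ≤ _ := pow_le_pow_left₀ (by norm_num) (by linarith [Real.exp_one_gt_d9]) _
    have h78 : (7 / 8 : ℝ) ≤ Real.exp (-(1 / 8)) := by linarith [hexp (1 / 8)]
    push_cast at hn2 ⊢
    calc _ ≤ _ := initialLaw_flipsAfter_succ_le p x m
      _ ≤ Real.exp 4 * Real.exp (-(1 / 8)) ^ (m / 2) :=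
        mul_le_mul h42 (pow_le_pow_left₀ (by norm_num) h78 _) (by positivity)
          (Real.exp_pos _).le
      _ = Real.exp (4 + (m / 2 : ℕ) * -(1 / 8)) := by
        rw [← Real.exp_nat_mul, ← Real.exp_add]
      _ ≤ _ := Real.exp_le_exp.2 (by linarith)

/-! ### Convergence -/

theorem flipsAtStep_B_unique {σ : Config} {i j : ℤ} {m m' : ℕ}
    (h : FlipsAtStep σ (.B i j) m) (h' : FlipsAtStep σ (.B i j) m') : m = m' := by
  obtain ⟨k, rfl, hk⟩ := (flipsAtStep_B_iff σ i j m).1 h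
  obtain ⟨l, rfl, hl⟩ := (flipsAtStep_B_iff σ i j m').1 h'
  rw [flip_unique hk hl]

theorem exists_not_flipsAfter (σ : Config) (x : Site) : ∃ n, ¬ FlipsAfter σ x n := by
  have hB : ∀ i j, ∃ n, ¬ FlipsAfter σ (.B i j) n := by
    intro i j
    by_contra! hall
    obtain ⟨m, -, hm⟩ := hall 0
    obtain ⟨m', hle, hm'⟩ := hall (m + 1)
    have := flipsAtStep_B_unique hm hm'
    omega
  cases x with
  | A i j =>
    obtain ⟨n0, h0⟩ := hB i j
    obtain ⟨n1, h1⟩ := hB (i + 1) j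
    obtain ⟨n2, h2⟩ := hB i (j + 1)
    refine ⟨n0 + n1 + n2 + 1, ?_⟩
    rintro ⟨m, hm, hflip⟩
    obtain ⟨m, rfl⟩ := Nat.exists_eq_add_of_le' (show 1 ≤ m by omega)
    rcases flipsAtStep_A_succ hflip with h | h | h
    · exact h0 ⟨m, by omega, h⟩
    · exact h1 ⟨m, by omega, h⟩
    · exact h2 ⟨m, by omega, h⟩
  | B i j => exact hB i j

theorem evolve_eq_of_not_flipsAfter {σ : Config} {x : Site} {n m : ℕ}
    (h : ¬ FlipsAfter σ x n) (hm : n ≤ m) : evolve σ m x = evolve σ n x := by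
  induction m, hm using Nat.le_induction with
  | base => rfl
  | succ m hm ih =>
    rw [← ih]
    by_contra hne
    exact h ⟨m, hm, hne⟩

end HexIsing

theorem mainTheorem3 :
    -- every `ℬ`-site flips at most once, from any initial configuration
    (∀ (σ : HexIsing.Config) (i j : ℤ) (m m' : ℕ),
      HexIsing.FlipsAtStep σ (.B i j) m → HexIsing.FlipsAtStep σ (.B i j) m' → m = m') ∧
    -- `σⁿ` converges (sitewise) to a limit configuration
    (∀ σ : HexIsing.Config, ∃ σlim : HexIsing.Config, ∀ x : HexIsing.Site,
      ∀ᶠ n in Filter.atTop, HexIsing.evolve σ n x = σlim x) ∧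
    -- and it does so exponentially fast, on both sublattices and for every density
    (∀ p : unitInterval, ∃ c : ℝ, 0 < c ∧ ∀ (x : HexIsing.Site) (n : ℕ),
      (HexIsing.initialLaw p).real {σ | HexIsing.FlipsAfter σ x n} ≤ Real.exp (-(c * n))) := by
  refine ⟨fun σ i j m m' => HexIsing.flipsAtStep_B_unique, fun σ => ?_, fun p => ?_⟩
  · choose N hN using HexIsing.exists_not_flipsAfter σ
    refine ⟨fun x => HexIsing.evolve σ (N x) x, fun x => ?_⟩
    filter_upwards [Filter.eventually_ge_atTop (N x)] with n hn
    exact HexIsing.evolve_eq_of_not_flipsAfter (hN x) hn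
  · exact ⟨(1 / 2) ^ 9 / 132, by norm_num, HexIsing.initialLaw_flipsAfter_le_exp p⟩
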